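/- **Definitions.** A template $T$ is a finite set with a finite family of relations of specified arities. An instance $I$ of $T$ is a finite set of elements together with a set of constraints $R(a_1,\dots,a_n)$, where $R$ is an $n$-ary relation of $T$ and the $a_k$ are elements of $I$. A partial solution is a partial map from the elements of $I$ to $T$ satisfying all constraints whose elements all lie in its domain; a solution is a total one. $T$ is *2-Helly* if for every instance $I$ and every partial solution $h$ of $I$ with domain of size $j>2$: if the restriction of $h$ to every $2$-element subset of its domain extends to a solution of $I$, then so does $h$. $T$ is a *coset template* if its carrier is a disjoint union of (finitely many, finite) groups, called carrier groups; every $n$-ary relation of $T$ is a right coset of a subgroup in a product $G_1\times\dots\times G_n$ of carrier groups; for every relation $R\subseteq G_1\times\dots\times G_n$ of $T$ and $\pi\in G_1\times\dots\times G_n$ the coset $R\pi$ is also a relation of $T$; and for every carrier group the unary relation $\{1\}$ consisting of its identity is a relation of $T$. If $R\subseteq G_1\times\dots\times G_n$, then $G_k$ is a constraining group of $a_k$ for each constraint $R(a_1,\dots,a_n)$. Below, instances are those in which every element $a$ has exactly one constraining group $G_a$. A pre-solution is a map $s$ with $s(a)\in G_a$ for every element $a$; pre-solutions form a group under pointwise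 multiplication. $I\cdot s$ denotes the instance obtained from $I$ by replacing each constraint $R(a_1,\dots,a_n)$ by $(R\pi)(a_1,\dots,a_n)$ with $\pi=(s(a_1),\dots,s(a_n))$. A *staged algorithm* computes, on each instance $I$, objects $\mathcal D_1(I),\dots,\mathcal D_{n(I)}(I)$, $n(I)\ge 1$. Whether it stops after stage $i$ is determined by $i$ and the object $\mathcal D_i(I)$ (and by the elements of $I$ and their constraining groups), and it stops for every $I$; the outcome (accept or reject) is determined by the final object $\mathcal D_{n(I)}(I)$ (and by the same data). For each set of elements with given constraining groups, the group of pre-solutions acts from the right on the objects. The algorithm *solves* CSP$(T)$ if it accepts exactly the instances that have a solution. It is *equivariant* if $n(I\cdot s)=n(I)$ and $\mathcal D_i(I\cdot s)=\mathcal D_i(I)\cdot s$ for every instance $I$, pre-solution $s$ of $I$ and $1\le i\le n(I)$. It is *local* if there is $d\in\mathbb N$ such that for every instance $I$ and $1\le i\le n(I)$ either (L0) holds, or both (L1) and (L2) hold, where $I'$ ranges over the instances with the same elements and constraining groups as $I$ and with $n(I')\ge i$: * (L0) there is a set $S$ of at most $d$ elements of $I$ such that $\mathcal D_i(I')=\mathcal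 D_i(I)$ whenever $I'$ and $I$ have the same constraints among elements of $S$; * (L1) there is a set $J\subseteq\{1,\dots,i-1\}$ of size at most $d$ such that $\mathcal D_i(I')=\mathcal D_i(I)$ whenever $\mathcal D_j(I')=\mathcal D_j(I)$ for all $j\in J$; * (L2) there is a set $S$ of at most $d$ elements of $I$ such that $\mathcal D_i(I)\cdot s=\mathcal D_i(I)$ for every pre-solution $s$ with $s(x)=1$ for all $x\in S$. **Theorem.** Let $T$ be a coset template. If some local equivariant algorithm solves CSP$(T)$, then $T$ is 2-Helly. -/

import Mathlib

universe u w

open scoped RightActions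

/-- A template: a finite relational structure, given by a finite carrier set and a finite
family of relations of specified arities on it. -/
structure Template where
  Carrier : Type u
  finite_carrier : Finite Carrier
  /-- the `n`-ary relations of the template -/
  rels : ∀ n : ℕ, Set (Set (Fin n → Carrier))
  finite_rels : {R : Σ n : ℕ, Set (Fin n → Carrier) | R.2 ∈ rels R.1}.Finite

/-- An instance over a template with set of elements `V`: a set of constraints `R(a 0, a 1, …)`,
where `R` is a relation of the template. (When `V` is finite, there are only finitely many
possible constraints.) -/
structure Template.Instance (T : Template.{u}) (V : Type) where
  /-- `con n R a` says that `R(a 0, …, a (n-1))` is a constraint of the instance -/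
  con : ∀ n : ℕ, Set (Fin n → T.Carrier) → (Fin n → V) → Prop
  con_rel : ∀ n R a, con n R a → R ∈ T.rels n

namespace Template.Instance

variable {T : Template.{u}} {V : Type}

/-- A solution: a total map satisfying all constraints. -/
def IsSolution (I : T.Instance V) (f : V → T.Carrier) : Prop :=
  ∀ (n : ℕ) (R : Set (Fin n → T.Carrier)) (a : Fin n → V), I.con n R a → (fun k => f (a k)) ∈ R

/-- A partial solution with domain `X`: a map on `X` satisfying all constraints whose elements
all belong to `X`. -/
def IsPartialSolution (I : T.Instance V) (X : Finset V) (h : X → T.Carrier) : Prop :=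
  ∀ (n : ℕ) (R : Set (Fin n → T.Carrier)) (a : Fin n → V) (ha : ∀ k, a k ∈ X),
    I.con n R a → (fun k => h ⟨a k, ha k⟩) ∈ R

/-- The map `h`, defined on `X`, extends to a solution. -/
def ExtendsToSolution (I : T.Instance V) (X : Finset V) (h : X → T.Carrier) : Prop :=
  ∃ f : V → T.Carrier, I.IsSolution f ∧ ∀ x : X, f x = h x

/-- The instance has a solution. -/
def Solvable (I : T.Instance V) : Prop :=
  ∃ f : V → T.Carrier, I.IsSolution f

/-- `h` is a `(k, j)`-anomaly: a partial solution of size `j` that does not extend to a solution,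
although its restriction to every `k`-element subset of its domain does. -/
def IsAnomaly (I : T.Instance V) (k j : ℕ) (X : Finset V) (h : X → T.Carrier) : Prop :=
  I.IsPartialSolution X h ∧ X.card = j ∧ ¬ I.ExtendsToSolution X h ∧
    ∀ (Y : Finset V) (hY : Y ⊆ X), Y.card = k →
      I.ExtendsToSolution Y (fun y => h ⟨y.1, hY y.2⟩)

end Template.Instance

/-- A template is 2-Helly if no (finite) instance admits a `(2, j)`-anomaly with `j > 2`. -/
def Template.TwoHelly (T : Template.{u}) : Prop :=
  ∀ (V : Type) [Finite V] (I : T.Instance V) (j : ℕ), 2 < j →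
    ∀ (X : Finset V) (h : X → T.Carrier), ¬ I.IsAnomaly 2 j X h

/-- A coset template. Its carrier is the disjoint union of the finite family `G` of finite groups.
Every relation is a right coset in a direct product `G (g 0) × … × G (g (n-1))` of carrier groups.
Since cosets are nonempty, a relation determines these groups, and the relations are therefore
listed according to the tuple `g` of groups. -/
structure CosetTemplate where
  ι : Type u
  finite_ι : Finite ι
  G : ι → Type u
  group : ∀ i, Group (G i)
  finite_G : ∀ i, Finite (G i)
  /-- the relations contained in `G (g 0) × … × G (g (n-1))` -/
  rels : ∀ (n : ℕ) (g : Fin n → ι), Set (Set (∀ k, G (g k)))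
  finite_rels : {R : Σ n : ℕ, Σ g : Fin n → ι, Set (∀ k, G (g k)) | R.2.2 ∈ rels R.1 R.2.1}.Finite
  isCoset : ∀ n g, ∀ R ∈ rels n g, ∃ (H : Subgroup (∀ k, G (g k))) (π : ∀ k, G (g k)),
    R = {x | ∃ h ∈ H, x = h * π}
  translate_mem : ∀ n g, ∀ R ∈ rels n g, ∀ π : ∀ k, G (g k), (fun x => x * π) '' R ∈ rels n g
  one_mem : ∀ i : ι, {1} ∈ rels 1 (fun _ => i)

attribute [instance] CosetTemplate.group

namespace CosetTemplate

/-- A tuple of elements of groups, as a tuple of elements of the disjoint union. -/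
def untype (T : CosetTemplate.{u}) {n : ℕ} (g : Fin n → T.ι) (p : ∀ k, T.G (g k)) :
    Fin n → Σ i, T.G i :=
  fun k => ⟨g k, p k⟩

/-- The template underlying a coset template. -/
def toTemplate (T : CosetTemplate.{u}) : Template.{u} where
  Carrier := Σ i, T.G i
  finite_carrier := by
    have := T.finite_ι
    have := T.finite_G
    infer_instance
  rels n := {S | ∃ (g : Fin n → T.ι) (R : Set (∀ k, T.G (g k))), R ∈ T.rels n g ∧
    S = T.untype g '' R}
  finite_rels := by
    refine (T.finite_rels.image (fun R => ⟨R.1, T.untype R.2.1 '' R.2.2⟩)).subset ?_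
    rintro ⟨n, S⟩ ⟨g, R, hR, hS⟩
    exact ⟨⟨n, g, R⟩, hR, congrArg (Sigma.mk n) hS.symm⟩

variable {T : CosetTemplate.{u}} {V : Type}

/-- The non-contradictory instances over a coset template, with set of elements `V`, in which the
unique constraining group of each element `v` is `T.G (γ v)`. -/
@[ext]
structure Instance (T : CosetTemplate.{u}) (γ : V → T.ι) where
  /-- `con n a` is the set of those relations `R` for which `R(a 0, …, a (n-1))` is a constraint -/
  con : ∀ (n : ℕ) (a : Fin n → V), Set (Set (∀ k, T.G (γ (a k))))
  con_rel : ∀ n a, ∀ R ∈ con n a, R ∈ T.rels n (fun k => γ (a k))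
  /-- every element occurs in some constraint -/
  covered : ∀ v : V, ∃ (n : ℕ) (a : Fin n → V), (con n a).Nonempty ∧ ∃ k, a k = v

/-- The group of pre-solutions of an instance with constraining groups `T.G (γ v)`. -/
abbrev PreSolution (T : CosetTemplate.{u}) (γ : V → T.ι) : Type u := ∀ v, T.G (γ v)

/-- The pre-solution `s` fixes the set `S`. -/
def PreSolution.Fixes {γ : V → T.ι} (s : T.PreSolution γ) (S : Finset V) : Prop :=
  ∀ x ∈ S, s x = 1

namespace Instance

variable {γ : V → T.ι}

/-- The same instance, over the underlying template. -/
def toInstance (I : T.Instance γ) : T.toTemplate.Instance V where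
  con n S a := ∃ R ∈ I.con n a, S = T.untype (fun k => γ (a k)) '' R
  con_rel := by
    rintro n S a ⟨R, hR, hS⟩
    exact ⟨fun k => γ (a k), R, I.con_rel n a R hR, hS⟩

/-- The action of pre-solutions on instances: each constraint `R(a 0, …, a (n-1))` is replaced by
`(R π)(a 0, …, a (n-1))`, where `π = (s (a 0), …, s (a (n-1)))`. -/
def act (I : T.Instance γ) (s : T.PreSolution γ) : T.Instance γ where
  con n a := {R' | ∃ R ∈ I.con n a, R' = (fun x k => x k * s (a k)) '' R}
  con_rel := by
    rintro n a R' ⟨R, hR, rfl⟩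
    exact T.translate_mem n _ R (I.con_rel n a R hR) (fun k => s (a k))
  covered := by
    intro v
    obtain ⟨n, a, ⟨R, hR⟩, hk⟩ := I.covered v
    exact ⟨n, a, ⟨_, R, hR, rfl⟩, hk⟩

/-- The restrictions of `I` and `I'` to `S` are equal: the two instances have the same
constraints among the elements of `S`. -/
def AgreeOn (I I' : T.Instance γ) (S : Finset V) : Prop :=
  ∀ (n : ℕ) (a : Fin n → V), (∀ k, a k ∈ S) → I.con n a = I'.con n a

end Instance

/-- A deterministic algorithm running in stages `1, 2, …` on instances of a coset template, with an
action of pre-solutions on its objects. As a function of the instance and of the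
previous objects, the object of a stage is just a function of the instance.
The set of objects and the action may depend on the set of elements and on their constraining
groups (that is, on the group of pre-solutions). -/
structure StagedAlgorithm (T : CosetTemplate.{u}) where
  Obj : ∀ {V : Type} [Finite V] (_ : V → T.ι), Type w
  /-- the (right) action of the group of pre-solutions on objects -/
  action : ∀ {V : Type} [Finite V] (γ : V → T.ι), MulAction (T.PreSolution γ)ᵐᵒᵖ (Obj γ)
  /-- `obj I i` is the object computed in the `i`-th stage on input `I`; only the stages
  from `1` up to the final one are relevant -/
  obj : ∀ {V : Type} [Finite V] {γ : V → T.ι}, T.Instance γ → ℕ → Obj γ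
  /-- whether the algorithm stops after computing a given object in stage `i` -/
  stops : ∀ {V : Type} [Finite V] {γ : V → T.ι}, ℕ → Obj γ → Prop
  terminates : ∀ {V : Type} [Finite V] {γ : V → T.ι} (I : T.Instance γ),
    ∃ i, 1 ≤ i ∧ stops i (obj I i)
  /-- the outcome, as a function of the final object -/
  accepts : ∀ {V : Type} [Finite V] {γ : V → T.ι}, Obj γ → Prop

attribute [instance] StagedAlgorithm.action

namespace StagedAlgorithm

variable [Finite V] {γ : V → T.ι}

/-- The number of stages on input `I`. -/
noncomputable def numStages (A : StagedAlgorithm.{u, w} T) (I : T.Instance γ) : ℕ :=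
  sInf {i | 1 ≤ i ∧ A.stops i (A.obj I i)}

/-- The algorithm solves the constraint satisfaction problem: it accepts exactly the instances
that have a solution. -/
def Solves (A : StagedAlgorithm.{u, w} T) : Prop :=
  ∀ (V : Type) [Finite V] (γ : V → T.ι) (I : T.Instance γ),
    A.accepts (A.obj I (A.numStages I)) ↔ I.toInstance.Solvable

/-- The algorithm commutes with the action of pre-solutions. -/
def IsEquivariant (A : StagedAlgorithm.{u, w} T) : Prop :=
  ∀ (V : Type) [Finite V] (γ : V → T.ι) (I : T.Instance γ) (s : T.PreSolution γ),
    A.numStages (I.act s) = A.numStages I ∧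
    ∀ i, 1 ≤ i → i ≤ A.numStages I → A.obj (I.act s) i = A.obj I i <• s

/-- (L0): for some set `S` of at most `d` elements, the `i`-th object depends only on the
restriction of the instance to `S`. -/
def L0 (A : StagedAlgorithm.{u, w} T) (d : ℕ) (I : T.Instance γ) (i : ℕ) : Prop :=
  ∃ S : Finset V, S.card ≤ d ∧
    ∀ I' : T.Instance γ, i ≤ A.numStages I' → I.AgreeOn I' S → A.obj I' i = A.obj I i

/-- (L1): the `i`-th object depends only on at most `d` of the objects of the previous stages. -/
def L1 (A : StagedAlgorithm.{u, w} T) (d : ℕ) (I : T.Instance γ) (i : ℕ) : Prop :=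
  ∃ J : Finset ℕ, J.card ≤ d ∧ (∀ j ∈ J, 1 ≤ j ∧ j < i) ∧
    ∀ I' : T.Instance γ, i ≤ A.numStages I' → (∀ j ∈ J, A.obj I' j = A.obj I j) →
      A.obj I' i = A.obj I i

/-- (L2): for some set `S` of at most `d` elements, the `i`-th object is invariant under all
pre-solutions fixing `S`. -/
def L2 (A : StagedAlgorithm.{u, w} T) (d : ℕ) (I : T.Instance γ) (i : ℕ) : Prop :=
  ∃ S : Finset V, S.card ≤ d ∧
    ∀ s : T.PreSolution γ, s.Fixes S → A.obj I i <• s = A.obj I i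

/-- The algorithm is local: for some locality bound `d`, independent of the instance, every stage
satisfies (L0), or both (L1) and (L2). -/
def IsLocal (A : StagedAlgorithm.{u, w} T) : Prop :=
  ∃ d : ℕ, ∀ (V : Type) [Finite V] (γ : V → T.ι) (I : T.Instance γ) (i : ℕ),
    1 ≤ i → i ≤ A.numStages I → A.L0 d I i ∨ (A.L1 d I i ∧ A.L2 d I i)

end StagedAlgorithm

end CosetTemplate

/-!
A failure of the 2-Helly property hides linear equations over a nontrivial abelian group, and local
equivariant algorithms cannot solve those.

*Abelian sections.* A minimal set on which an anomaly fails to extend contains three elements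
`p`, `q`, `r` such that solutions extending all of it but `p`, `q` or `r` exist. Ratios of these
three solutions solve a homogeneous system of subgroup constraints (pp-definable with constants) and
have the values `(x, 1, z)` and `(1, y, z)` at `(p, q, r)`, while no solution has the values
`(1, 1, z)` (`exists_homogeneousSystem_of_not_twoHelly`). The values at `r` of the solutions
that are `1` at `p`, and of those that are `1` at `q`, commute modulo those that are `1` at both.
Copies of the system, glued together, therefore force equations `a + b = c` in an abelian group in
which the class of `z` is nontrivial (`exists_commGroup_solution`). Conversely, integer solutions of
such equations are realized by products of powers of the two given solutions
(`encode_mem_solutions`).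

*The equations.* On the complete graph with `n` vertices, consider antisymmetric flows for which the
total flow out of a vertex is prescribed to be `0`, except for one vertex, where it is `1`. Partial
sums turn this into ternary equations. The totals of an antisymmetric flow add up to `0`, so there
is no such flow, even with values in the abelian group, if `1` is taken to mean the class of `z`
(`eq_one_of_flowEquations`). But there are integer flows violating the prescription at any single
vertex `v`, and the defect moves from `v` to `w` by changing the flow along the edge `vw` only
(`exists_move_defect`).

*Locality.* Let `I` be the instance with all totals `0` and `I'` the one with a total `1`. A flow
with a defect at `v` is a pre-solution `s` for which `I · s` agrees with `I'` away from `v`. By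
induction on the stages, every object computed on `I'` equals that on `I · s` if `v` avoids a
support of bounded size: (L1) collects the supports of boundedly many earlier stages, and as the
defect can be moved away from all these, (L2) allows the support to shrink again
(`StagedAlgorithm.exists_support`). So the algorithm has the same outcome on `I'` and on the
solvable instance `I · s`, although `I'` is unsolvable.
-/

namespace CosetTemplate

/-! ### Typed solutions -/

theorem untype_injective (T : CosetTemplate.{u}) {n : ℕ} (g : Fin n → T.ι) :
    Function.Injective (T.untype g) := by
  intro x y h
  funext k
  exact eq_of_heq (Sigma.mk.inj (congrFun h k)).2

theorem mk_mem_untype_image (T : CosetTemplate.{u}) {n : ℕ} (g : Fin n → T.ι)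
    (x : ∀ k, T.G (g k)) (R : Set (∀ k, T.G (g k))) :
    (fun k => (⟨g k, x k⟩ : Σ i, T.G i)) ∈ T.untype g '' R ↔ x ∈ R :=
  (T.untype_injective g).mem_set_image (a := x)

/-- Solutions of a covered instance respect the constraining groups, so they may be taken to be
pre-solutions. -/
theorem Instance.solvable_iff {T : CosetTemplate.{u}} {V : Type} {γ : V → T.ι}
    (I : T.Instance γ) :
    I.toInstance.Solvable ↔
      ∃ s : T.PreSolution γ, ∀ n a, ∀ R ∈ I.con n a, (fun k => s (a k)) ∈ R := by
  constructor
  · rintro ⟨f, hf⟩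
    have hγ : ∀ v, ∃ x : T.G (γ v), f v = ⟨γ v, x⟩ := by
      intro v
      obtain ⟨n, a, ⟨R, hR⟩, k, rfl⟩ := I.covered v
      obtain ⟨x, -, hx⟩ := hf n _ a ⟨R, hR, rfl⟩
      exact ⟨x k, (congrFun hx k).symm⟩
    choose s hs using hγ
    obtain rfl : f = fun v => ⟨γ v, s v⟩ := funext hs
    exact ⟨s, fun n a R hR =>
      (T.mk_mem_untype_image (fun k => γ (a k)) (fun k => s (a k)) R).1 (hf n _ a ⟨R, hR, rfl⟩)⟩
  · rintro ⟨s, hs⟩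
    refine ⟨fun v => ⟨γ v, s v⟩, ?_⟩
    rintro n _ a ⟨R, hR, rfl⟩
    exact (T.mk_mem_untype_image (fun k => γ (a k)) (fun k => s (a k)) R).2 (hs n a R hR)

/-! ### Local equivariant algorithms and indistinguishable instances -/

namespace StagedAlgorithm

section Indistinguishable

theorem exists_notMem_biUnion {V W : Type} [Fintype W] [DecidableEq W] (own : V → Finset W)
    {c m : ℕ} (hown : ∀ e, (own e).card ≤ c)
    (hm : m * c < Fintype.card W) (U : Finset V) (hU : U.card ≤ m) :
    ∃ w, w ∉ U.biUnion own := by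
  by_contra! h
  have h1 : (U.biUnion own).card ≤ U.card * c :=
    Finset.card_biUnion_le_card_mul _ _ _ fun e _ => hown e
  rw [Finset.eq_univ_iff_forall.2 h, Finset.card_univ] at h1
  exact absurd (h1.trans (Nat.mul_le_mul_right c hU)) (not_le.2 hm)

variable {T : CosetTemplate.{u}} {V : Type} [Finite V] {γ : V → T.ι} {W : Type} [Fintype W]
  [DecidableEq W]

theorem numStages_spec (A : StagedAlgorithm.{u, w} T) (I : T.Instance γ) :
    1 ≤ A.numStages I ∧ A.stops (A.numStages I) (A.obj I (A.numStages I)) :=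
  Nat.sInf_mem (s := {i | 1 ≤ i ∧ A.stops i (A.obj I i)}) (A.terminates I)

theorem numStages_le (A : StagedAlgorithm.{u, w} T) (I : T.Instance γ) {i : ℕ} (h1 : 1 ≤ i)
    (h : A.stops i (A.obj I i)) : A.numStages I ≤ i :=
  Nat.sInf_le (s := {i | 1 ≤ i ∧ A.stops i (A.obj I i)}) ⟨h1, h⟩

/-- Suppose that `I` can be turned into `I'` by a pre-solution up to a defect at any vertex
`w : W`, and that the defect can be moved from `w` to `w'` by a change at elements owned by `w` or
`w'` only. Then no stage distinguishes `I'` from the translate of `I` by a pre-solution with its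
defect outside a small support. (L1) enlarges the support of a stage; (L2), after moving the defect
away from the enlarged support, shrinks it back to size `d`. -/
theorem exists_support (A : StagedAlgorithm.{u, w} T) (hE : A.IsEquivariant) {d : ℕ}
    (hd : ∀ (V : Type) [Finite V] (γ : V → T.ι) (I : T.Instance γ) (i : ℕ),
      1 ≤ i → i ≤ A.numStages I → A.L0 d I i ∨ (A.L1 d I i ∧ A.L2 d I i))
    (I I' : T.Instance γ) (own : V → Finset W) {c : ℕ} (hown : ∀ e, (own e).card ≤ c)
    (P : W → Set (T.PreSolution γ))
    (hagree : ∀ w, ∀ s ∈ P w, ∀ S : Finset V, w ∉ S.biUnion own → I'.AgreeOn (I.act s) S)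
    (hmove : ∀ w w', ∀ s ∈ P w, ∃ s' ∈ P w', ∀ e, w ∉ own e → w' ∉ own e → s' e = s e)
    (hcard : (d + d * d) * c < Fintype.card W) (i : ℕ) (h1 : 1 ≤ i) (hi : i ≤ A.numStages I)
    (hi' : i ≤ A.numStages I') :
    ∃ S : Finset V, S.card ≤ d ∧
      ∀ w, w ∉ S.biUnion own → ∀ s ∈ P w, A.obj I' i = A.obj (I.act s) i := by
  classical
  induction i using Nat.strong_induction_on with
  | _ i ih =>
  have hact : ∀ s, i ≤ A.numStages (I.act s) := fun s => by rwa [(hE V γ I s).1]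
  rcases hd V γ I' i h1 hi' with ⟨S, hS, h⟩ | ⟨⟨J, hJ, hJi, h⟩, S, hS, hfix⟩
  · exact ⟨S, hS, fun w hw s hs => (h _ (hact s) (hagree w s hs S hw)).symm⟩
  · have ih' : ∀ j, ∃ S : Finset V, j ∈ J → S.card ≤ d ∧
        ∀ w, w ∉ S.biUnion own → ∀ s ∈ P w, A.obj I' j = A.obj (I.act s) j := by
      intro j
      by_cases hj : j ∈ J
      · obtain ⟨S, hS⟩ := ih j (hJi j hj).2 (hJi j hj).1 ((hJi j hj).2.le.trans hi)
          ((hJi j hj).2.le.trans hi')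
        exact ⟨S, fun _ => hS⟩
      · exact ⟨∅, fun h => absurd h hj⟩
    choose F hF using ih'
    have hcardU : (S ∪ J.biUnion F).card ≤ d + d * d := by
      refine (Finset.card_union_le _ _).trans (Nat.add_le_add hS ?_)
      exact (Finset.card_biUnion_le_card_mul _ _ _ fun j hj => (hF j hj).1).trans
        (Nat.mul_le_mul_right d hJ)
    refine ⟨S, hS, fun w hw s hs => ?_⟩
    obtain ⟨w', hw'⟩ := exists_notMem_biUnion own hown hcard _ hcardU
    obtain ⟨s', hs', hss'⟩ := hmove w w' s hs
    have hsub : ∀ U : Finset V, U ⊆ S ∪ J.biUnion F → w' ∉ U.biUnion own := fun U hU hmem =>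
      hw' (Finset.biUnion_subset_biUnion_of_subset_left own hU hmem)
    have key : A.obj I' i = A.obj (I.act s') i := by
      refine (h _ (hact s') fun j hj => ((hF j hj).2 w' (hsub _ ?_) s' hs').symm).symm
      exact (Finset.subset_biUnion_of_mem F hj).trans Finset.subset_union_right
    have hfix' := hfix (s'⁻¹ * s) fun x hx => by
      have h1 : w ∉ own x := fun hmem => hw (Finset.mem_biUnion.2 ⟨x, hx, hmem⟩)
      have h2 : w' ∉ own x := fun hmem =>
        hsub S Finset.subset_union_left (Finset.mem_biUnion.2 ⟨x, hx, hmem⟩)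
      simp [hss' x h1 h2]
    rw [← hfix', key, (hE V γ I s').2 i h1 hi, (hE V γ I s).2 i h1 hi, smul_smul,
      ← MulOpposite.op_mul, mul_inv_cancel_left]

/-- Under the hypotheses of `exists_support`, the instance `I'` and a translate of `I` go through
the same stages up to the end, and hence get the same outcome. -/
theorem solvable_iff_of_indistinguishable (A : StagedAlgorithm.{u, w} T) (hE : A.IsEquivariant)
    (hS : A.Solves) {d : ℕ}
    (hd : ∀ (V : Type) [Finite V] (γ : V → T.ι) (I : T.Instance γ) (i : ℕ),
      1 ≤ i → i ≤ A.numStages I → A.L0 d I i ∨ (A.L1 d I i ∧ A.L2 d I i))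
    (I I' : T.Instance γ) (own : V → Finset W) {c : ℕ} (hown : ∀ e, (own e).card ≤ c)
    (P : W → Set (T.PreSolution γ)) (hP : ∃ w, (P w).Nonempty)
    (hagree : ∀ w, ∀ s ∈ P w, ∀ S : Finset V, w ∉ S.biUnion own → I'.AgreeOn (I.act s) S)
    (hmove : ∀ w w', ∀ s ∈ P w, ∃ s' ∈ P w', ∀ e, w ∉ own e → w' ∉ own e → s' e = s e)
    (hcard : (d + d * d) * c < Fintype.card W) :
    ∃ w, ∃ s ∈ P w, (I'.toInstance.Solvable ↔ (I.act s).toInstance.Solvable) := by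
  have key : ∀ i, 1 ≤ i → i ≤ A.numStages I → i ≤ A.numStages I' →
      ∃ w, ∃ s ∈ P w, A.obj I' i = A.obj (I.act s) i := by
    intro i h1 hi hi'
    obtain ⟨S, hSd, h⟩ := A.exists_support hE hd I I' own hown P hagree hmove hcard i h1 hi hi'
    obtain ⟨w', hw'⟩ := exists_notMem_biUnion own hown hcard S (hSd.trans (Nat.le_add_right _ _))
    obtain ⟨w, s, hs⟩ := hP
    obtain ⟨s', hs', -⟩ := hmove w w' s hs
    exact ⟨w', s', hs', h w' hw' s' hs'⟩
  have heq : A.numStages I' = A.numStages I := by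
    rcases le_total (A.numStages I) (A.numStages I') with hle | hle
    · obtain ⟨w, s, -, h⟩ := key _ (A.numStages_spec I).1 le_rfl hle
      refine le_antisymm (A.numStages_le I' (A.numStages_spec I).1 ?_) hle
      rw [h, ← (hE V γ I s).1]
      exact (A.numStages_spec (I.act s)).2
    · obtain ⟨w, s, -, h⟩ := key _ (A.numStages_spec I').1 hle le_rfl
      refine le_antisymm hle ?_
      rw [← (hE V γ I s).1]
      refine A.numStages_le _ (A.numStages_spec I').1 ?_
      rw [← h]
      exact (A.numStages_spec I').2
  obtain ⟨w, s, hs, h⟩ := key _ (A.numStages_spec I).1 le_rfl heq.ge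
  refine ⟨w, s, hs, ?_⟩
  rw [← hS V γ I', ← hS V γ (I.act s), heq, h, (hE V γ I s).1]

end Indistinguishable

end StagedAlgorithm

/-! ### Homogeneous systems of subgroup constraints -/

/-- A set of constraints over a coset template all of whose relations are subgroups. Unlike in an
instance, elements may remain unconstrained. -/
structure HomogeneousSystem (T : CosetTemplate.{u}) {V : Type} (γ : V → T.ι) where
  con : ∀ (n : ℕ) (a : Fin n → V), Set (Subgroup (∀ k, T.G (γ (a k))))
  con_rel : ∀ n a, ∀ H ∈ con n a, (H : Set (∀ k, T.G (γ (a k)))) ∈ T.rels n (fun k => γ (a k))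

namespace HomogeneousSystem

variable {T : CosetTemplate.{u}} {V : Type} {γ : V → T.ι}

/-- The solutions of a homogeneous system form a subgroup of the group of pre-solutions. -/
def solutions (C : T.HomogeneousSystem γ) : Subgroup (T.PreSolution γ) where
  carrier := {s | ∀ n a, ∀ H ∈ C.con n a, (fun k => s (a k)) ∈ H}
  mul_mem' hs ht _ _ H hH := H.mul_mem (hs _ _ H hH) (ht _ _ H hH)
  one_mem' _ _ H _ := H.one_mem
  inv_mem' hs _ _ H hH := H.inv_mem (hs _ _ H hH)

/-- The element `v` occurs in some constraint. -/
def Covers (C : T.HomogeneousSystem γ) (v : V) : Prop :=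
  ∃ (n : ℕ) (a : Fin n → V), (C.con n a).Nonempty ∧ ∃ k, a k = v

theorem mem_solutions_of_eq (C : T.HomogeneousSystem γ) {s s' : T.PreSolution γ}
    (hs : s ∈ C.solutions) (h : ∀ v, C.Covers v → s' v = s v) : s' ∈ C.solutions := by
  intro n a H hH
  have : (fun k => s' (a k)) = fun k => s (a k) :=
    funext fun k => h _ ⟨n, a, ⟨H, hH⟩, k, rfl⟩
  rw [this]
  exact hs n a H hH

/-- The instance consisting of a homogeneous system and of the constraints `v = g v` for the
elements `v` of `P`. In order to obtain an instance, unconstrained elements are pinned as well. -/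
def pin (C : T.HomogeneousSystem γ) (P : Set V) (g : T.PreSolution γ) : T.Instance γ where
  con n a := {R | (∃ H ∈ C.con n a, R = H) ∨
    (n = 1 ∧ (∀ k, a k ∈ P ∨ ¬ C.Covers (a k)) ∧ R = {fun k => g (a k)})}
  con_rel := by
    rintro n a R (⟨H, hH, rfl⟩ | ⟨rfl, -, rfl⟩)
    · exact C.con_rel n a H hH
    · obtain ⟨v, rfl⟩ : ∃ v, a = fun _ => v :=
        ⟨a 0, funext fun k => by rw [Subsingleton.elim k 0]⟩
      simpa using T.translate_mem 1 _ _ (T.one_mem (γ v)) (fun _ => g v)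
  covered v := by
    by_cases hv : C.Covers v
    · obtain ⟨n, a, ⟨H, hH⟩, hk⟩ := hv
      exact ⟨n, a, ⟨_, Or.inl ⟨H, hH, rfl⟩⟩, hk⟩
    · exact ⟨1, fun _ => v, ⟨_, Or.inr ⟨rfl, fun _ => Or.inr hv, rfl⟩⟩, 0, rfl⟩

theorem exists_solution_of_pin_solvable (C : T.HomogeneousSystem γ) (P : Set V)
    (g : T.PreSolution γ) (h : (C.pin P g).toInstance.Solvable) :
    ∃ s ∈ C.solutions, ∀ v ∈ P, s v = g v := by
  obtain ⟨s, hs⟩ := (Instance.solvable_iff _).1 h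
  refine ⟨s, fun n a H hH => hs n a _ (Or.inl ⟨H, hH, rfl⟩), fun v hv => ?_⟩
  have h1 := hs 1 (fun _ => v) {fun _ => g v} (Or.inr ⟨rfl, fun _ => Or.inl hv, rfl⟩)
  exact congrFun h1 0

theorem pin_one_act_solvable (C : T.HomogeneousSystem γ) (P : Set V) (s : T.PreSolution γ) :
    ((C.pin P 1).act s).toInstance.Solvable := by
  refine (Instance.solvable_iff _).2 ⟨s, ?_⟩
  rintro n a _ ⟨R, hR, rfl⟩
  refine ⟨1, ?_, by ext; simp⟩
  rcases hR with ⟨H, -, rfl⟩ | ⟨-, -, rfl⟩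
  · exact H.one_mem
  · rfl

/-- A solution of the homogeneous system translates the pins `v = 1` to the pins `v = g v`, as far
as it takes the values required by `g`. -/
theorem pin_agreeOn (C : T.HomogeneousSystem γ) (P : Set V) (g s : T.PreSolution γ)
    (hs : s ∈ C.solutions) (S : Finset V) (h : ∀ v ∈ S, v ∈ P ∨ ¬ C.Covers v → s v = g v) :
    (C.pin P g).AgreeOn ((C.pin P 1).act s) S := by
  intro n a ha
  have h1 : ∀ H ∈ C.con n a, (fun (x : ∀ k, T.G (γ (a k))) k => x k * s (a k)) '' (H : Set _) =
      (H : Set _) := by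
    intro H hH
    ext x
    constructor
    · rintro ⟨y, hy, rfl⟩
      exact H.mul_mem hy (hs n a H hH)
    · intro hx
      exact ⟨fun k => x k * (s (a k))⁻¹, H.mul_mem hx (H.inv_mem (hs n a H hH)), by simp⟩
  have h2 : (∀ k, a k ∈ P ∨ ¬ C.Covers (a k)) →
      (fun (x : ∀ k, T.G (γ (a k))) k => x k * s (a k)) '' {fun k => (1 : T.PreSolution γ) (a k)} =
        {fun k => g (a k)} := by
    intro hP
    rw [Set.image_singleton]
    congr 1
    funext k
    simpa using h _ (ha k) (hP k)
  ext R
  constructor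
  · rintro (⟨H, hH, rfl⟩ | ⟨hn, hP, rfl⟩)
    · exact ⟨_, Or.inl ⟨H, hH, rfl⟩, (h1 H hH).symm⟩
    · exact ⟨_, Or.inr ⟨hn, hP, rfl⟩, (h2 hP).symm⟩
  · rintro ⟨_, ⟨H, hH, rfl⟩ | ⟨hn, hP, rfl⟩, rfl⟩
    · exact Or.inl ⟨H, hH, h1 H hH⟩
    · exact Or.inr ⟨hn, hP, h2 hP⟩

/-- Copies of a homogeneous system, glued together: every `ρ` in `Λ` gives rise to a copy in which
the element `v` is represented by `(v, ρ v)`. -/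
def copies (C : T.HomogeneousSystem γ) {L : Type} (Λ : Set (V → L)) :
    T.HomogeneousSystem (fun e : V × L => γ e.1) where
  con n a := {H | (∃ ρ ∈ Λ, ∀ k, (a k).2 = ρ (a k).1) ∧ H ∈ C.con n (fun k => (a k).1)}
  con_rel _ _ H hH := C.con_rel _ _ H hH.2

theorem mem_solutions_copies (C : T.HomogeneousSystem γ) {L : Type} (Λ : Set (V → L))
    (s : T.PreSolution (fun e : V × L => γ e.1)) :
    s ∈ (C.copies Λ).solutions ↔ ∀ ρ ∈ Λ, (fun v => s (v, ρ v)) ∈ C.solutions := by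
  constructor
  · intro hs ρ hρ n a H hH
    exact hs n (fun k => (a k, ρ (a k))) H ⟨⟨ρ, hρ, fun _ => rfl⟩, hH⟩
  · rintro hs n a H ⟨⟨ρ, hρ, ha⟩, hH⟩
    have h := hs ρ hρ n _ H hH
    have : (fun k => s (a k)) = fun k => s ((a k).1, ρ (a k).1) := by
      funext k
      have hk := ha k
      generalize a k = e at hk ⊢
      obtain ⟨v, i⟩ := e
      obtain rfl : i = ρ v := hk
      rfl
    rw [this]
    exact h

end HomogeneousSystem

/-! ### From an anomaly to a homogeneous system -/

/-- The component of an element of the disjoint union in the group `T.G i`, or `1` if it lies in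
another group. -/
noncomputable def component (T : CosetTemplate.{u}) (i : T.ι) (x : Σ i, T.G i) : T.G i :=
  open Classical in if h : x.1 = i then h ▸ x.2 else 1

theorem mk_component (T : CosetTemplate.{u}) {i : T.ι} {x : Σ i, T.G i} (h : x.1 = i) :
    (⟨i, T.component i x⟩ : Σ i, T.G i) = x := by
  obtain ⟨j, x⟩ := x
  obtain rfl : j = i := h
  simp [component]

theorem component_mk (T : CosetTemplate.{u}) (i : T.ι) (x : T.G i) :
    T.component i ⟨i, x⟩ = x := by
  simp [component]

/-- Given solutions `fp`, `fq`, `fr` that agree with `k` on `Y` except at `p`, `q`, `r`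
respectively, the ratios `α = fp / fr` and `β = fq / fr` solve the homogeneous system obtained from
`I` by pinning the remaining elements of `Y` to `1`. Since no solution agrees with `k` on all of
`Y`, no solution of that system is `1` at `p` and `q` and agrees with `α` at `r`. -/
theorem exists_homogeneousSystem_of_solutions {T : CosetTemplate.{u}} {V : Type}
    (I : T.toTemplate.Instance V) (Y : Finset V) (k : V → Σ i, T.G i) {p q r : V} (hp : p ∈ Y)
    (hq : q ∈ Y) (hr : r ∈ Y) (hpq : p ≠ q) (hpr : p ≠ r) (hqr : q ≠ r)
    {fp fq fr : V → Σ i, T.G i}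
    (hfp : I.IsSolution fp) (hfq : I.IsSolution fq) (hfr : I.IsSolution fr)
    (hfpk : ∀ v ∈ Y, v ≠ p → fp v = k v) (hfqk : ∀ v ∈ Y, v ≠ q → fq v = k v)
    (hfrk : ∀ v ∈ Y, v ≠ r → fr v = k v)
    (hk : ¬ ∃ f, I.IsSolution f ∧ ∀ v ∈ Y, f v = k v) :
    ∃ (γ : V → T.ι) (C : T.HomogeneousSystem γ), ∃ α ∈ C.solutions, ∃ β ∈ C.solutions,
      α q = 1 ∧ β p = 1 ∧ α r = β r ∧
        ∀ σ ∈ C.solutions, σ p = 1 → σ q = 1 → σ r ≠ α r := by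
  classical
  let cov : V → Prop := fun v => ∃ n S a, I.con n S a ∧ ∃ j, a j = v
  let γ : V → T.ι := fun v => (fr v).1
  let b : T.PreSolution γ := fun v => (fr v).2
  have sol_congr : ∀ f f' : V → Σ i, T.G i, I.IsSolution f → (∀ v, cov v → f' v = f v) →
      I.IsSolution f' := by
    intro f f' hf h n S a hS
    have : (fun j => f' (a j)) = fun j => f (a j) :=
      funext fun j => h _ ⟨n, S, a, hS, j, rfl⟩
    rw [this]
    exact hf n S a hS
  have fst_eq : ∀ f, I.IsSolution f → ∀ v, cov v → (f v).1 = γ v := by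
    rintro f hf v ⟨n, S, a, hS, j, rfl⟩
    obtain ⟨g, R, -, rfl⟩ := I.con_rel n S a hS
    obtain ⟨x, -, hx⟩ := hf n _ a hS
    obtain ⟨y, -, hy⟩ := hfr n _ a hS
    have hx' : (⟨g j, x j⟩ : Σ i, T.G i) = f (a j) := congrFun hx j
    have hy' : (⟨g j, y j⟩ : Σ i, T.G i) = fr (a j) := congrFun hy j
    change (f (a j)).1 = (fr (a j)).1
    rw [← hx', ← hy']
  let pinned : V → Prop := fun v => v ∈ Y ∧ v ≠ p ∧ v ≠ q ∧ v ≠ r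
  let C : T.HomogeneousSystem γ :=
    { con := fun n a => {H | (∃ π, {x | ∃ h ∈ H, x = h * π} ∈ T.rels n (fun j => γ (a j)) ∧
          I.con n (T.untype (fun j => γ (a j)) '' {x | ∃ h ∈ H, x = h * π}) a) ∨
        (n = 1 ∧ (∀ j, pinned (a j)) ∧ H = ⊥)}
      con_rel := by
        rintro n a H (⟨π, hπ, -⟩ | ⟨rfl, -, rfl⟩)
        · convert T.translate_mem n _ _ hπ π⁻¹ using 1
          ext x
          constructor
          · exact fun hx => ⟨x * π, ⟨x, hx, rfl⟩, by simp⟩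
          · rintro ⟨_, ⟨y, hy, rfl⟩, rfl⟩
            simpa using hy
        · obtain ⟨v, rfl⟩ : ∃ v, a = fun _ => v :=
            ⟨a 0, funext fun j => by rw [Subsingleton.elim j 0]⟩
          simpa using T.one_mem (γ v) }
  -- every constraint of `I` arises from a constraint of `C`
  have con_typed : ∀ n S a, I.con n S a → ∃ (H : Subgroup (∀ j, T.G (γ (a j)))) (π : _),
      S = T.untype (fun j => γ (a j)) '' {x | ∃ h ∈ H, x = h * π} ∧ H ∈ C.con n a := by
    intro n S a hS
    obtain ⟨g, R, hR, rfl⟩ := I.con_rel n S a hS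
    obtain ⟨y, -, hy⟩ := hfr n _ a hS
    obtain rfl : g = fun j => γ (a j) := by
      funext j
      have hy' : (⟨g j, y j⟩ : Σ i, T.G i) = fr (a j) := congrFun hy j
      change g j = (fr (a j)).1
      rw [← hy']
    obtain ⟨H, π, rfl⟩ := T.isCoset _ _ R hR
    exact ⟨H, π, rfl, Or.inl ⟨π, hR, hS⟩⟩
  have base_mem : ∀ n a (H : Subgroup (∀ j, T.G (γ (a j)))) (π : ∀ j, T.G (γ (a j))),
      I.con n (T.untype (fun j => γ (a j)) '' {x | ∃ h ∈ H, x = h * π}) a →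
        (fun j => b (a j)) ∈ {x | ∃ h ∈ H, x = h * π} := by
    intro n a H π h
    exact (T.mk_mem_untype_image (fun j => γ (a j)) (fun j => b (a j)) _).1 (hfr n _ a h)
  have sol_of_mem : ∀ σ ∈ C.solutions, I.IsSolution (fun v => (⟨γ v, σ v * b v⟩ : Σ i, T.G i)) := by
    intro σ hσ n S a hS
    obtain ⟨H, π, rfl, hH⟩ := con_typed n S a hS
    obtain ⟨h, hh, hb⟩ := base_mem n a H π hS
    refine (T.mk_mem_untype_image (fun j => γ (a j)) (fun j => σ (a j) * b (a j)) _).2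
      ⟨(fun j => σ (a j)) * h, H.mul_mem (hσ n a H hH) hh, ?_⟩
    rw [mul_assoc, ← hb]
    rfl
  have mem_of_sol : ∀ σ : T.PreSolution γ,
      I.IsSolution (fun v => (⟨γ v, σ v * b v⟩ : Σ i, T.G i)) → (∀ v, pinned v → σ v = 1) →
        σ ∈ C.solutions := by
    rintro σ hσ hpin n a H (⟨π, -, hcon⟩ | ⟨-, ha, rfl⟩)
    · obtain ⟨h, hh, hb⟩ := base_mem n a H π hcon
      obtain ⟨h', hh', hb'⟩ := (T.mk_mem_untype_image (fun j => γ (a j))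
        (fun j => σ (a j) * b (a j)) _).1 (hσ n _ a hcon)
      have : (fun j => σ (a j)) = h' * h⁻¹ := by
        have h1 : (fun j => σ (a j)) * (fun j => b (a j)) = h' * π := hb'
        rw [hb] at h1
        rw [eq_mul_inv_iff_mul_eq]
        exact mul_right_cancel (b := π) (by rw [mul_assoc, h1])
      rw [this]
      exact H.mul_mem hh' (H.inv_mem hh)
    · rw [Subgroup.mem_bot]
      exact funext fun j => hpin _ (ha j)
  let ratio : (V → Σ i, T.G i) → T.PreSolution γ := fun f v =>
    if cov v then T.component (γ v) (f v) * (b v)⁻¹ else 1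
  have ratio_eq_one : ∀ f v, f v = fr v → ratio f v = 1 := by
    intro f v h
    have : T.component (γ v) (fr v) = b v := T.component_mk (γ v) (b v)
    simp only [ratio, h, this, mul_inv_cancel, ite_self]
  have ratio_mul : ∀ f, I.IsSolution f → ∀ v, cov v →
      (⟨γ v, ratio f v * b v⟩ : Σ i, T.G i) = f v := by
    intro f hf v hv
    simp only [ratio, if_pos hv, inv_mul_cancel_right]
    exact T.mk_component (fst_eq f hf v hv)
  have ratio_mem : ∀ f, I.IsSolution f → (∀ v, pinned v → f v = fr v) → ratio f ∈ C.solutions :=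
    fun f hf h => mem_of_sol _ (sol_congr f _ hf (ratio_mul f hf))
      fun v hv => ratio_eq_one f v (h v hv)
  refine ⟨γ, C, ratio fp, ratio_mem fp hfp ?_, ratio fq, ratio_mem fq hfq ?_, ?_, ?_, ?_, ?_⟩
  · exact fun v hv => (hfpk v hv.1 hv.2.1).trans (hfrk v hv.1 hv.2.2.2).symm
  · exact fun v hv => (hfqk v hv.1 hv.2.2.1).trans (hfrk v hv.1 hv.2.2.2).symm
  · exact ratio_eq_one fp q ((hfpk q hq hpq.symm).trans (hfrk q hq hqr).symm)
  · exact ratio_eq_one fq p ((hfqk p hp hpq).trans (hfrk p hp hpr).symm)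
  · simp only [ratio, hfpk r hr hpr.symm, hfqk r hr hqr.symm]
  · intro σ hσ hσp hσq hσr
    refine hk ⟨fun v => if v ∈ Y then k v else ⟨γ v, σ v * b v⟩,
      sol_congr _ _ (sol_of_mem σ hσ) fun v hv => ?_, fun v hv => if_pos hv⟩
    change (if v ∈ Y then k v else ⟨γ v, σ v * b v⟩) = _
    split_ifs with hvY
    · have of_one : σ v = 1 → v ≠ r → k v = ⟨γ v, σ v * b v⟩ := by
        intro h1 hvr
        rw [h1, one_mul, ← hfrk v hvY hvr]
      by_cases hvp : v = p
      · subst hvp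
        exact of_one hσp hpr
      by_cases hvq : v = q
      · subst hvq
        exact of_one hσq hqr
      by_cases hvr : v = r
      · subst hvr
        rw [hσr, ratio_mul fp hfp v hv, hfpk v hr hvp]
      · have h1 := hσ 1 (fun _ => v) ⊥ (Or.inr ⟨rfl, fun _ => ⟨hvY, hvp, hvq, hvr⟩, rfl⟩)
        exact of_one (congrFun (Subgroup.mem_bot.1 h1) 0) hvr
    · rfl

/-- If a template is not 2-Helly, then an inclusion-minimal set on which an anomaly fails to
extend has at least three elements, and it extends after omitting any one of them. -/
theorem exists_homogeneousSystem_of_not_twoHelly {T : CosetTemplate.{u}}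
    (h : ¬ T.toTemplate.TwoHelly) :
    ∃ (V : Type) (_ : Finite V) (γ : V → T.ι) (C : T.HomogeneousSystem γ) (p q r : V),
      ∃ α ∈ C.solutions, ∃ β ∈ C.solutions, α q = 1 ∧ β p = 1 ∧ α r = β r ∧
        ∀ σ ∈ C.solutions, σ p = 1 → σ q = 1 → σ r ≠ α r := by
  classical
  simp only [Template.TwoHelly, not_forall, not_not] at h
  obtain ⟨V, hV, I, j, hj, X, h, -, rfl, hnot, hpair⟩ := h
  obtain ⟨f₀, hf₀⟩ : I.Solvable := by
    obtain ⟨Y, hY, hcard⟩ := Finset.exists_subset_card_eq hj.le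
    obtain ⟨f, hf, -⟩ := hpair Y hY hcard
    exact ⟨f, hf⟩
  let k : V → T.toTemplate.Carrier := fun v => if hv : v ∈ X then h ⟨v, hv⟩ else f₀ v
  let good : Finset V → Prop := fun Y => ∃ f, I.IsSolution f ∧ ∀ v ∈ Y, f v = k v
  have hX : ¬ good X := by
    rintro ⟨f, hf, hfk⟩
    exact hnot ⟨f, hf, fun x => by simpa [k] using hfk x x.2⟩
  have hsmall : ∀ Y ⊆ X, Y.card ≤ 2 → good Y := by
    intro Y hY hcard
    obtain ⟨Z, hYZ, hZX, hZ⟩ := Finset.exists_subsuperset_card_eq hY hcard hj.le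
    obtain ⟨f, hf, hfh⟩ := hpair Z hZX hZ
    exact ⟨f, hf, fun v hv => by simpa [k, hY hv] using hfh ⟨v, hYZ hv⟩⟩
  obtain ⟨Y, hY, hmin⟩ := Finset.exists_min_image {Y ∈ X.powerset | ¬ good Y} Finset.card
    ⟨X, by simpa using hX⟩
  simp only [Finset.mem_filter, Finset.mem_powerset] at hY hmin
  have herase : ∀ p ∈ Y, ∃ f, I.IsSolution f ∧ ∀ v ∈ Y, v ≠ p → f v = k v := by
    intro p hp
    by_contra hbad
    have hbad' : ¬ good (Y.erase p) := fun ⟨f, hf, hfk⟩ =>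
      hbad ⟨f, hf, fun v hv hvp => hfk v (Finset.mem_erase.2 ⟨hvp, hv⟩)⟩
    have := hmin _ ⟨(Finset.erase_subset p Y).trans hY.1, hbad'⟩
    exact absurd (Finset.card_erase_lt_of_mem hp) (not_lt.2 this)
  obtain ⟨p, hp, q, hq, r, hr, hpq, hpr, hqr⟩ := Finset.two_lt_card.1
    (not_le.1 fun hle => hY.2 (hsmall Y hY.1 hle))
  obtain ⟨fp, hfp, hfpk⟩ := herase p hp
  obtain ⟨fq, hfq, hfqk⟩ := herase q hq
  obtain ⟨fr, hfr, hfrk⟩ := herase r hr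
  obtain ⟨γ, C, h⟩ := exists_homogeneousSystem_of_solutions I Y k hp hq hr hpq hpr hqr hfp hfq hfr
    hfpk hfqk hfrk hY.2
  exact ⟨V, hV, γ, C, p, q, r, h⟩

/-! ### Gadgets for sums in an abelian section -/

section Gadget

variable {T : CosetTemplate.{u}} {V : Type} {γ : V → T.ι} {L : Type}

/-- The copy of a system that belongs to the triple `t` of labels represents `p`, `q`, `r` by
elements labelled with the components of `t`, which it shares with other copies, and all other
elements by elements of its own. -/
noncomputable def place (p q r : V) (t : L × L × L) (v : V) : L ⊕ L × L × L :=
  open Classical in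
  if v = p then Sum.inl t.1 else if v = q then Sum.inl t.2.1 else if v = r then Sum.inl t.2.2
  else Sum.inr t

/-- The gadget system: one copy of `C` for every triple of labels in `E`. It expresses that the
values of the labels `i`, `j` add up to that of `k` whenever `(i, j, k)` is in `E`. -/
noncomputable abbrev gadgets (C : T.HomogeneousSystem γ) (p q r : V) (E : Set (L × L × L)) :
    T.HomogeneousSystem (fun e : V × (L ⊕ L × L × L) => γ e.1) :=
  C.copies (place p q r '' E)

/-- The pre-solution encoding integer values `x` of the labels. The elements `p`, `q`, `r` of label
`l` get the value `α ^ x l`, `β ^ x l` and `α ^ x l`; the copy for `(i, j, k)` is assigned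
`α ^ x i * β ^ x j`. -/
noncomputable def encode (α β : T.PreSolution γ) (q : V) (x : L → ℤ) :
    T.PreSolution (fun e : V × (L ⊕ L × L × L) => γ e.1)
  | (v, Sum.inl l) => open Classical in if v = q then β v ^ x l else α v ^ x l
  | (v, Sum.inr t) => α v ^ x t.1 * β v ^ x t.2.1

theorem encode_mem_solutions (C : T.HomogeneousSystem γ) {p q r : V} {α β : T.PreSolution γ}
    (hα : α ∈ C.solutions) (hβ : β ∈ C.solutions) (hpq : p ≠ q) (hqr : q ≠ r) (hαq : α q = 1)
    (hβp : β p = 1) (hr : α r = β r) {E : Set (L × L × L)} {x : L → ℤ}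
    (hx : ∀ t ∈ E, x t.1 + x t.2.1 = x t.2.2) :
    encode α β q x ∈ (gadgets C p q r E).solutions := by
  rw [HomogeneousSystem.mem_solutions_copies]
  rintro _ ⟨t, ht, rfl⟩
  have : (fun v => encode α β q x (v, place p q r t v)) = α ^ x t.1 * β ^ x t.2.1 := by
    funext v
    have val : ∀ i, place p q r t v = i →
        encode α β q x (v, place p q r t v) = encode α β q x (v, i) := fun i h => by rw [h]
    by_cases hvp : v = p
    · subst hvp
      rw [val (Sum.inl t.1) (by simp [place])]
      simp [encode, hpq, hβp]
    by_cases hvq : v = q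
    · subst hvq
      rw [val (Sum.inl t.2.1) (by simp [place, hvp])]
      simp [encode, hαq]
    by_cases hvr : v = r
    · subst hvr
      rw [val (Sum.inl t.2.2) (by simp [place, hvp, hvq])]
      simp [encode, hvq, ← hr, ← zpow_add, hx t ht]
    · rw [val (Sum.inr t) (by simp [place, hvp, hvq, hvr])]
      simp [encode]
  rw [this]
  exact mul_mem (zpow_mem hα _) (zpow_mem hβ _)

/-- Let `H` be the projection to `p`, `q`, `r` of the solution group of `C`. The values at `r` of
those members of `H` that are `1` at `p`, and of those that are `1` at `q`, form subgroups `M₁`,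
`M₂`. Modulo the subgroup `N` of values of members that are `1` at both, these commute, because
`(1, y, z)` and `(x, 1, z')` have the commutator `(1, 1, ⁅z, z'⁆)`. Every solution of the gadget
system thus gives a solution of the corresponding equations in the abelian group `M₁ ⊓ M₂ / N`, in
which the class of `α r` is nontrivial. The label `o` stands for zero. -/
theorem exists_commGroup_solution (C : T.HomogeneousSystem γ) {p q r : V} {α β : T.PreSolution γ}
    (hα : α ∈ C.solutions) (hβ : β ∈ C.solutions) (hpq : p ≠ q) (hpr : p ≠ r) (hqr : q ≠ r)
    (hαq : α q = 1) (hβp : β p = 1) (hr : α r = β r)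
    (hno : ∀ σ ∈ C.solutions, σ p = 1 → σ q = 1 → σ r ≠ α r)
    {E : Set (L × L × L)} (o : L) (hright : ∀ l, (l, o, l) ∈ E) (hleft : ∀ l, (o, l, l) ∈ E)
    {P : Set L} (ho : o ∈ P) {c : L → ℤ} (hc : c o = 0)
    {s : T.PreSolution (fun e : V × (L ⊕ L × L × L) => γ e.1)}
    (hs : s ∈ (gadgets C p q r E).solutions)
    (hsP : ∀ v, ∀ l ∈ P, s (v, Sum.inl l) = encode α β q c (v, Sum.inl l)) :
    ∃ (A : Type u) (_ : CommGroup A) (a : A) (y : L → A), a ≠ 1 ∧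
      (∀ t ∈ E, y t.1 * y t.2.1 = y t.2.2) ∧ ∀ l ∈ P, y l = a ^ c l := by
  rw [HomogeneousSystem.mem_solutions_copies] at hs
  have copy : ∀ t ∈ E, ∃ σ ∈ C.solutions, σ p = s (p, Sum.inl t.1) ∧ σ q = s (q, Sum.inl t.2.1) ∧
      σ r = s (r, Sum.inl t.2.2) := by
    intro t ht
    have hp : place p q r t p = Sum.inl t.1 := by simp [place]
    have hq : place p q r t q = Sum.inl t.2.1 := by simp [place, hpq.symm]
    have hr : place p q r t r = Sum.inl t.2.2 := by simp [place, hpr.symm, hqr.symm]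
    exact ⟨_, hs _ ⟨t, ht, rfl⟩, by rw [hp], by rw [hq], by rw [hr]⟩
  have hop : s (p, Sum.inl o) = 1 := by simp [hsP p o ho, encode, hpq, hc]
  have hoq : s (q, Sum.inl o) = 1 := by simp [hsP q o ho, encode, hc]
  have copy₂ : ∀ l, ∃ σ ∈ C.solutions, σ p = s (p, Sum.inl l) ∧ σ q = 1 ∧
      σ r = s (r, Sum.inl l) := fun l => by simpa [hoq] using copy _ (hright l)
  have copy₁ : ∀ l, ∃ σ ∈ C.solutions, σ p = 1 ∧ σ q = s (q, Sum.inl l) ∧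
      σ r = s (r, Sum.inl l) := fun l => by simpa [hop] using copy _ (hleft l)
  let ev : ∀ v, T.PreSolution γ →* T.G (γ v) := fun v => Pi.evalMonoidHom (fun v => T.G (γ v)) v
  let M₁ : Subgroup (T.G (γ r)) := (C.solutions ⊓ (ev p).ker).map (ev r)
  let M₂ : Subgroup (T.G (γ r)) := (C.solutions ⊓ (ev q).ker).map (ev r)
  let M : Subgroup (T.G (γ r)) := M₁ ⊓ M₂
  let N : Subgroup M := ((C.solutions ⊓ (ev p).ker ⊓ (ev q).ker).map (ev r)).subgroupOf M
  have mem_N : ∀ {z : M} (σ : T.PreSolution γ), σ ∈ C.solutions → σ p = 1 → σ q = 1 →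
      σ r = z → z ∈ N := fun σ h1 h2 h3 h4 => ⟨σ, ⟨⟨h1, h2⟩, h3⟩, h4⟩
  have normal : N.Normal := by
    constructor
    rintro ⟨n, hn⟩ ⟨τ, ⟨⟨hτ, hτp⟩, hτq⟩, hτr⟩ ⟨g, ⟨σ, ⟨hσ, hσp⟩, hσr⟩, hg⟩
    have hτp : τ p = 1 := hτp
    have hτq : τ q = 1 := hτq
    have hτr : τ r = n := hτr
    have hσr : σ r = g := hσr
    exact mem_N (σ * τ * σ⁻¹) (mul_mem (mul_mem hσ hτ) (inv_mem hσ)) (by simp [hτp])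
      (by simp [hτq]) (by simp [hτr, hσr])
  have comm : ∀ x y : M ⧸ N, x * y = y * x := by
    intro x y
    induction x using QuotientGroup.induction_on with | H x =>
    induction y using QuotientGroup.induction_on with | H y =>
    obtain ⟨x, ⟨σ, ⟨hσ, hσp⟩, hσr⟩, hx⟩ := x
    obtain ⟨y, hy, ⟨τ, ⟨hτ, hτq⟩, hτr⟩⟩ := y
    have hσp : σ p = 1 := hσp
    have hτq : τ q = 1 := hτq
    have hσr : σ r = x := hσr
    have hτr : τ r = y := hτr
    refine QuotientGroup.eq.2 (mem_N ((σ * τ)⁻¹ * (τ * σ)) (mul_mem (inv_mem (mul_mem hσ hτ))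
      (mul_mem hτ hσ)) (by simp [hσp]) (by simp [hτq]) (by simp [hσr, hτr]))
  let _ : CommGroup (M ⧸ N) := { QuotientGroup.Quotient.group N with mul_comm := comm }
  have hM : ∀ l, s (r, Sum.inl l) ∈ M := by
    intro l
    obtain ⟨σ, hσ, hσp, -, hσr⟩ := copy₁ l
    obtain ⟨τ, hτ, -, hτq, hτr⟩ := copy₂ l
    exact ⟨⟨σ, ⟨hσ, hσp⟩, hσr⟩, ⟨τ, ⟨hτ, hτq⟩, hτr⟩⟩
  have hαM : α r ∈ M := ⟨⟨β, ⟨hβ, hβp⟩, hr.symm⟩, ⟨α, ⟨hα, hαq⟩, rfl⟩⟩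
  refine ⟨M ⧸ N, inferInstance, ((⟨α r, hαM⟩ : M) : M ⧸ N),
    fun l => ((⟨s (r, Sum.inl l), hM l⟩ : M) : M ⧸ N), ?_, ?_, ?_⟩
  · intro h1
    obtain ⟨σ, ⟨⟨hσ, hσp⟩, hσq⟩, hσr⟩ := (QuotientGroup.eq_one_iff _).1 h1
    exact hno σ hσ hσp hσq hσr
  · rintro ⟨i, j, k⟩ ht
    obtain ⟨ω, hω, hωp, hωq, hωr⟩ := copy _ ht
    obtain ⟨σ, hσ, hσp, hσq, hσr⟩ := copy₂ i
    obtain ⟨τ, hτ, hτp, hτq, hτr⟩ := copy₁ j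
    exact QuotientGroup.eq.2 (mem_N ((σ * τ)⁻¹ * ω) (mul_mem (inv_mem (mul_mem hσ hτ)) hω)
      (by simp [hσp, hτp, hωp]) (by simp [hσq, hτq, hωq]) (by simp [hσr, hτr, hωr]))
  · intro l hl
    have h1 : (⟨s (r, Sum.inl l), hM l⟩ : M) = ⟨α r, hαM⟩ ^ c l := by
      apply Subtype.ext
      simp [hsP r l hl, encode, hqr.symm]
    change ((⟨s (r, Sum.inl l), hM l⟩ : M) : M ⧸ N) = _
    rw [h1]
    rfl

end Gadget

/-! ### The linear system of a complete graph -/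

section CompleteGraph

variable {n : ℕ}

/-- The variables of the linear system on the complete graph with vertex set `Fin n`: a constant
`none`, standing for zero; for vertices `v`, `w`, the flow `some (v, Sum.inl w)` from `v` to `w`;
for a vertex `v` and `i ≤ n`, the total flow `some (v, Sum.inr i)` from `v` to the vertices
below `i`. -/
abbrev FlowLabel (n : ℕ) : Type := Option (Fin n × (Fin n ⊕ Fin (n + 1)))

/-- The ternary equations `x i + x j = x k` of the linear system, as triples `(i, j, k)`. They say
that `none` is zero, that the partial sums at a vertex arise from each other by adding a flow, and
that the flow is antisymmetric. -/
inductive FlowEquation (n : ℕ) : FlowLabel n × FlowLabel n × FlowLabel n → Prop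
  | right (l) : FlowEquation n (l, none, l)
  | left (l) : FlowEquation n (none, l, l)
  | step (v w : Fin n) : FlowEquation n
      (some (v, Sum.inr w.castSucc), some (v, Sum.inl w), some (v, Sum.inr w.succ))
  | antisymm (v w : Fin n) : FlowEquation n (some (v, Sum.inl w), some (w, Sum.inl v), none)

/-- The variables of the linear system with a prescribed value. -/
inductive FlowPinned (n : ℕ) : FlowLabel n → Prop
  | zero : FlowPinned n none
  | diag (v : Fin n) : FlowPinned n (some (v, Sum.inl v))
  | first (v : Fin n) : FlowPinned n (some (v, Sum.inr 0))
  | total (v : Fin n) : FlowPinned n (some (v, Sum.inr (Fin.last n)))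

/-- The prescribed values of the pinned variables: the total flow out of the vertex `v₀` is `1`,
and all others are `0`. -/
def flowValue (v₀ : Fin n) : FlowLabel n → ℤ
  | some (v, Sum.inr i) => if v = v₀ ∧ i = Fin.last n then 1 else 0
  | _ => 0

theorem mul_prod_eq_last {A : Type*} [CommMonoid A] (n : ℕ) (y : Fin (n + 1) → A)
    (x : Fin n → A) (h : ∀ j, y j.castSucc * x j = y j.succ) : y 0 * ∏ j, x j = y (Fin.last n) := by
  induction n with
  | zero => simp
  | succ n ih =>
    rw [Fin.prod_univ_castSucc, ← mul_assoc]
    have := ih (fun j => y j.castSucc) (fun j => x j.castSucc) fun j => h j.castSucc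
    simp only [Fin.castSucc_zero] at this
    rw [this, h, Fin.succ_last]

/-- The total of an antisymmetric flow out of all vertices is zero. So the linear system has no
solution in which the prescribed total flow is a nontrivial group element. -/
theorem eq_one_of_flowEquations {A : Type*} [CommGroup A] {v₀ : Fin n} {a : A}
    {y : FlowLabel n → A} (hy : ∀ t, FlowEquation n t → y t.1 * y t.2.1 = y t.2.2)
    (hP : ∀ l, FlowPinned n l → y l = a ^ flowValue v₀ l) (hn : n ≠ 0) : a = 1 := by
  have htot : ∀ v, ∏ w, y (some (v, Sum.inl w)) = if v = v₀ then a else 1 := by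
    intro v
    have h := mul_prod_eq_last n (fun i => y (some (v, Sum.inr i)))
      (fun w => y (some (v, Sum.inl w))) fun w => hy _ (.step v w)
    have h0 : (0 : Fin (n + 1)) ≠ Fin.last n := fun h0 => hn (congrArg Fin.val h0).symm
    rw [hP _ (.first v), hP _ (.total v)] at h
    simp only [flowValue, h0, and_false, if_false, zpow_zero, one_mul, and_true] at h
    rw [h]
    split_ifs <;> simp
  have h1 : ∏ v, ∏ w, y (some (v, Sum.inl w)) = a := by simp [htot]
  rw [← h1, ← Finset.prod_product']
  refine Finset.prod_involution (fun t _ => t.swap) ?_ ?_ (by simp) (by simp)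
  · rintro ⟨v, w⟩ -
    simpa [hP _ .zero, flowValue] using hy _ (.antisymm v w)
  · rintro ⟨v, w⟩ - hne heq
    obtain rfl : w = v := congrArg Prod.fst heq
    exact hne (by simpa [flowValue] using hP _ (.diag w))

/-- The values of the variables of the linear system for the flow `x`. -/
def flowAssignment (x : Fin n → Fin n → ℤ) : FlowLabel n → ℤ
  | none => 0
  | some (v, Sum.inl w) => x v w
  | some (v, Sum.inr i) => Fin.partialSum (x v) i

/-- The vertex at which a variable is situated, if there is one. -/
def FlowLabel.vertex : FlowLabel n → Finset (Fin n)
  | none => ∅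
  | some (v, _) => {v}

theorem FlowLabel.card_vertex_le (l : FlowLabel n) : l.vertex.card ≤ 1 := by
  rcases l with _ | ⟨v, l⟩ <;> simp [vertex]

/-- The antisymmetric integer flows in which the total flow out of a vertex is as prescribed, except
that it is too small by one at `v`. -/
def defectiveFlows (v₀ v : Fin n) : Set (Fin n → Fin n → ℤ) :=
  {x | (∀ i j, x i j + x j i = 0) ∧
    ∀ i, ∑ j, x i j = (if i = v₀ then 1 else 0) - if i = v then 1 else 0}

theorem zero_mem_defectiveFlows (v₀ : Fin n) : 0 ∈ defectiveFlows v₀ v₀ := by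
  simp [defectiveFlows]

/-- The defect of a flow moves from `v` to `w` by sending one more unit from `v` to `w`. -/
theorem exists_move_defect {v₀ v : Fin n} (w : Fin n) {x : Fin n → Fin n → ℤ}
    (hx : x ∈ defectiveFlows v₀ v) :
    ∃ x' ∈ defectiveFlows v₀ w, ∀ i, i ≠ v → i ≠ w → x' i = x i := by
  refine ⟨fun i j => x i j + (if i = v ∧ j = w then 1 else 0) - (if i = w ∧ j = v then 1 else 0),
    ⟨fun i j => ?_, fun i => ?_⟩, fun i hv hw => ?_⟩
  · have := hx.1 i j
    simp only [and_comm (a := j = v), and_comm (a := j = w)]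
    linarith
  · rw [Finset.sum_sub_distrib, Finset.sum_add_distrib, hx.2 i]
    simp only [ite_and]
    by_cases h1 : i = v <;> by_cases h2 : i = w <;> simp [h1, h2]
  · simp [hv, hw]

theorem flowAssignment_equation {x : Fin n → Fin n → ℤ} (hx : ∀ i j, x i j + x j i = 0)
    {t : FlowLabel n × FlowLabel n × FlowLabel n} (ht : FlowEquation n t) :
    flowAssignment x t.1 + flowAssignment x t.2.1 = flowAssignment x t.2.2 := by
  cases ht with
  | right l => simp [flowAssignment]
  | left l => simp [flowAssignment]
  | step v w => exact (Fin.partialSum_succ _ _).symm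
  | antisymm v w => exact hx v w

theorem flowAssignment_pinned {v₀ v : Fin n} {x : Fin n → Fin n → ℤ}
    (hx : x ∈ defectiveFlows v₀ v) {l : FlowLabel n} (hl : FlowPinned n l) (hv : v ∉ l.vertex) :
    flowAssignment x l = flowValue v₀ l := by
  cases hl with
  | zero => rfl
  | diag w =>
    have := hx.1 w w
    simp only [flowAssignment, flowValue]
    linarith
  | first w =>
    have h0 : (0 : Fin (n + 1)) ≠ Fin.last n := fun h0 =>
      (w.pos.ne (congrArg Fin.val h0))
    simp [flowAssignment, flowValue, h0]
  | total w =>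
    have hw : w ≠ v := fun h => hv (by simp [FlowLabel.vertex, h])
    have h := mul_prod_eq_last (A := Multiplicative ℤ) n
      (fun i => Multiplicative.ofAdd (Fin.partialSum (x w) i))
      (fun j => Multiplicative.ofAdd (x w j)) fun j => by
        rw [← ofAdd_add, ← Fin.partialSum_succ]
    rw [← ofAdd_sum, ← ofAdd_add, Fin.partialSum_zero, zero_add, hx.2 w] at h
    simpa [flowAssignment, flowValue, hw] using (Multiplicative.ofAdd.injective h).symm

theorem flowAssignment_congr {x x' : Fin n → Fin n → ℤ} {l : FlowLabel n}
    (h : ∀ v ∈ l.vertex, x' v = x v) : flowAssignment x' l = flowAssignment x l := by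
  rcases l with _ | ⟨v, w | i⟩
  · rfl
  all_goals simp [flowAssignment, h v (by simp [FlowLabel.vertex])]

end CompleteGraph

/-! ### The lower bound -/

/-- The algorithm cannot tell the solvable homogeneous gadget instance of the complete graph's
linear system from the unsolvable one in which a single total flow is prescribed to be `1`: the
pre-solutions encoding integer flows with a defect at a vertex `v` translate one into the other
except at the total flow out of `v`. -/
theorem twoHelly_of_exists_local_equivariant (T : CosetTemplate.{u})
    (h : ∃ A : StagedAlgorithm.{u, w} T, A.IsEquivariant ∧ A.IsLocal ∧ A.Solves) :
    T.toTemplate.TwoHelly := by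
  classical
  by_contra hT
  obtain ⟨A, hE, ⟨d, hd⟩, hS⟩ := h
  obtain ⟨V, hV, γ, C, p, q, r, α, hα, β, hβ, hαq, hβp, hr, hno⟩ :=
    exists_homogeneousSystem_of_not_twoHelly hT
  -- if two of the three elements coincided, then `α` or `1` would violate `hno`
  have hpq : p ≠ q := by
    rintro rfl
    exact hno α hα hαq hαq rfl
  have hpr : p ≠ r := by
    rintro rfl
    exact hno 1 C.solutions.one_mem rfl rfl (hr.trans hβp).symm
  have hqr : q ≠ r := by
    rintro rfl
    exact hno 1 C.solutions.one_mem rfl rfl hαq.symm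
  obtain ⟨n, hn⟩ : ∃ n, n = (d + d * d) * 2 + 1 := ⟨_, rfl⟩
  have hn0 : n ≠ 0 := by omega
  let v₀ : Fin n := ⟨0, Nat.pos_of_ne_zero hn0⟩
  let E : Set (FlowLabel n × FlowLabel n × FlowLabel n) := {t | FlowEquation n t}
  let D := gadgets C p q r E
  let P : Set (V × (FlowLabel n ⊕ FlowLabel n × FlowLabel n × FlowLabel n)) :=
    {e | ∃ l, FlowPinned n l ∧ e.2 = Sum.inl l}
  let g := encode α β q (flowValue v₀)
  have unsolvable : ¬ (D.pin P g).toInstance.Solvable := by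
    intro h
    obtain ⟨s, hs, hsP⟩ := D.exists_solution_of_pin_solvable P g h
    obtain ⟨B, _, a, y, ha, hy, hyP⟩ := exists_commGroup_solution C hα hβ hpq hpr hqr hαq hβp hr
      hno (E := E) none FlowEquation.right FlowEquation.left (P := {l | FlowPinned n l})
      FlowPinned.zero (c := flowValue v₀) rfl hs fun v l hl => hsP (v, Sum.inl l) ⟨l, hl, rfl⟩
    exact ha (eq_one_of_flowEquations hy hyP hn0)
  -- the values at unconstrained elements do not matter, but these elements are pinned by `g`
  let sol : (Fin n → Fin n → ℤ) →
      T.PreSolution (fun e : V × (FlowLabel n ⊕ FlowLabel n × FlowLabel n × FlowLabel n) => γ e.1) :=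
    fun x e => if D.Covers e then encode α β q (flowAssignment x) e else g e
  let own : V × (FlowLabel n ⊕ FlowLabel n × FlowLabel n × FlowLabel n) → Finset (Fin n) :=
    fun e => Sum.elim FlowLabel.vertex (fun t => t.1.vertex ∪ t.2.1.vertex) e.2
  have hown : ∀ e, (own e).card ≤ 2 := by
    rintro ⟨v, l | t⟩
    · exact l.card_vertex_le.trans one_le_two
    · exact (Finset.card_union_le _ _).trans
        (Nat.add_le_add t.1.card_vertex_le t.2.1.card_vertex_le)
  obtain ⟨v, s, -, hiff⟩ := A.solvable_iff_of_indistinguishable hE hS hd (D.pin P 1) (D.pin P g)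
    own hown (fun v => sol '' defectiveFlows v₀ v) ⟨v₀, _, 0, zero_mem_defectiveFlows v₀, rfl⟩
    (by
      rintro v _ ⟨x, hx, rfl⟩ S hvS
      refine D.pin_agreeOn P g _ (D.mem_solutions_of_eq (encode_mem_solutions C hα hβ hpq hqr hαq
        hβp hr fun t ht => flowAssignment_equation hx.1 ht) fun e he => if_pos he) S ?_
      rintro ⟨b, i⟩ hS' he
      by_cases hcov : D.Covers (b, i)
      · obtain ⟨l, hl, rfl⟩ : ∃ l, FlowPinned n l ∧ i = Sum.inl l :=
          he.resolve_right (not_not.2 hcov)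
        have hvl : v ∉ l.vertex := fun hmem => hvS (Finset.mem_biUnion.2 ⟨_, hS', hmem⟩)
        simp only [if_pos hcov, g, encode, flowAssignment_pinned hx hl hvl]
      · exact if_neg hcov)
    (by
      rintro v w _ ⟨x, hx, rfl⟩
      obtain ⟨x', hx', hxx'⟩ := exists_move_defect w hx
      refine ⟨_, ⟨x', hx', rfl⟩, ?_⟩
      have congr : ∀ l : FlowLabel n, v ∉ l.vertex → w ∉ l.vertex →
          flowAssignment x' l = flowAssignment x l := fun l h1 h2 =>
        flowAssignment_congr fun i hi => hxx' i (fun h => h1 (h ▸ hi)) fun h => h2 (h ▸ hi)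
      rintro ⟨b, l | t⟩ hv hw
      · simp only [sol, encode, congr l hv hw]
      · have h1 := Finset.notMem_union.1 hv
        have h2 := Finset.notMem_union.1 hw
        simp only [sol, encode, congr t.1 h1.1 h2.1, congr t.2.1 h1.2 h2.2])
    (by rw [Fintype.card_fin]; omega)
  exact unsolvable (hiff.2 (D.pin_one_act_solvable P s))

end CosetTemplate

theorem theorem1 (T : CosetTemplate.{u})
    (h : ∃ A : CosetTemplate.StagedAlgorithm.{u, w} T, A.IsEquivariant ∧ A.IsLocal ∧ A.Solves) :
    T.toTemplate.TwoHelly :=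
  CosetTemplate.twoHelly_of_exists_local_equivariant T h
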